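/- Let $K$ be a field, let $S$ be a $K$-scheme of finite type and let $S'\to S$ be a finite étale cover (a finite étale morphism of schemes, $S'$ being a $K$-scheme through $S$). Let $L/K$ be a field extension where $L$ is a local field, that is, a field with a nontrivial absolute value which either is locally compact, or is nonarchimedean with valuation ring a henselian discrete valuation ring (such as the maximal unramified extension of a nonarchimedean local field). Fix an algebraic closure $\overline L$ of $L$, and give $S(L)=\operatorname{Hom}_K(\operatorname{Spec} L,S)$ the analytic topology, generated by the sets $\{s\in U(L) : f(s)\in V\}$ for $U\subseteq S$ affine open, $f\in\mathcal O_S(U)$ and $V\subseteq L$ open. For $s\in S(L)$ let $S'_s=S'\times_S\operatorname{Spec} L$ be the fibre at $s$, and let $L(S'_s(\overline L))\subseteq\overline L$ be the field generated over $L$ by the residue fields of the points of $S'_s(\overline L)$, embedded in $\overline L$ through these points. Then, for every $s\in S(L)$, $L(S'_s(\overline L))/L$ is a finite Galois extension, and there are an integer $n\ge 0$, finite groups $H_1,\dots,H_n$ and pairwise disjoint open subsets $U_1,\dots,U_n$ of $S(L)$ with $S(L)=U_1\cup\dots\cup U_n$ such that, for all $i\in\{1,\dots,n\}$ and all $s\in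 S(L)$, $$s\in U_i\iff \operatorname{Gal}\bigl(L(S'_s(\overline L))/L\bigr)\simeq H_i .$$ -/

import Mathlib

open CategoryTheory CategoryTheory.Limits AlgebraicGeometry
open scoped NNReal

universe u

noncomputable section

/-- A local field: a field with a nontrivial absolute value which is locally compact (so `ℝ`, `ℂ`,
or a finite extension of `ℚ_p` or of `𝔽_p((t))`), or which is nonarchimedean, with
valuation ring a henselian discrete valuation ring (so complete discretely valued fields, and also
the maximal unramified extension of a nonarchimedean local field, which is neither locally compact
nor complete). -/
def IsLocalField (L : Type u) [NontriviallyNormedField L] : Prop :=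
  LocallyCompactSpace L ∨
    ∃ _ : IsUltrametricDist L,
      IsDiscreteValuationRing (NormedField.valuation (K := L)).integer ∧
        HenselianLocalRing (NormedField.valuation (K := L)).integer

/-- The set `S(L) = Hom_K(Spec L, S)` of `L`-points of a `K`-scheme `p : S ⟶ Spec K`. -/
def KPoints {K : Type u} [Field K] {S : Scheme.{u}} (p : S ⟶ Spec (.of K))
    (L : Type u) [Field L] [Algebra K L] : Type u :=
  {s : Spec (.of L) ⟶ S // s ≫ p = Spec.map (CommRingCat.ofHom (algebraMap K L))}

/-- The value `f(t) ∈ L` of a global function `f` on a scheme `U` at a point `t : Spec L ⟶ U`. -/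
def evalAt {L : Type u} [Field L] {U : Scheme.{u}} (t : Spec (.of L) ⟶ U) (f : Γ(U, ⊤)) : L :=
  (Scheme.ΓSpecIso (.of L)).hom.hom (t.appTop.hom f)

/-- The analytic topology on `S(L)`, for a topological field `L`: it is generated by the sets of
those points that lie in an affine open `U` of `S` and at which a given regular function on `U`
takes its value in a given open subset `V` of `L`. -/
instance KPoints.instTopologicalSpace {K : Type u} [Field K] {S : Scheme.{u}}
    (p : S ⟶ Spec (.of K)) (L : Type u) [Field L] [Algebra K L] [TopologicalSpace L] :
    TopologicalSpace (KPoints p L) :=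
  TopologicalSpace.generateFrom
    {W | ∃ (U : S.Opens) (_ : IsAffineOpen U) (f : Γ(U.toScheme, ⊤)) (V : Set L), IsOpen V ∧
      W = {s | ∃ t : Spec (.of L) ⟶ U.toScheme, t ≫ U.ι = s.1 ∧ evalAt t f ∈ V}}

/-- For an `L`-scheme `q : X ⟶ Spec L` and an extension `Ω` of `L`, the subfield `L(X(Ω))` of `Ω`
generated over `L` by the residue fields of the points `x ∈ X(Ω)`, embedded in `Ω` through `x`. -/
def fieldOfPoints {L : Type u} [Field L] {X : Scheme.{u}} (q : X ⟶ Spec (.of L))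
    (Ω : Type u) [Field Ω] [Algebra L Ω] : IntermediateField L Ω :=
  IntermediateField.adjoin L
    (⋃ x : KPoints q Ω, Set.range (Scheme.SpecToEquivOfField Ω X x.1).2.hom)

/-- The field `L(S'_s(Ω))` generated by the `Ω`-points of the fibre `S'_s = S' ×_S Spec L` of
`f : S' ⟶ S` at an `L`-point `s` of `S`. -/
def fibreField {K : Type u} [Field K] {S S' : Scheme.{u}} (f : S' ⟶ S) {p : S ⟶ Spec (.of K)}
    {L : Type u} [Field L] [Algebra K L] (s : KPoints p L)
    (Ω : Type u) [Field Ω] [Algebra L Ω] : IntermediateField L Ω :=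
  fieldOfPoints (pullback.snd f s.1) Ω

end

/-!
Proof idea. In a complete field, by the implicit function theorem, and in a henselian discretely
valued field, by Hensel's lemma, a simple root of a polynomial persists nearby when the coefficients
move a little. Étale algebras being locally standard étale, a point of an étale `R`-algebra over
`t₀ : R → L` therefore deforms to points over all `t : R → L` close to `t₀`.

If `B` and `C` are finite free over `A` and `B` is étale, then `T ↦ Isom_T(T ⊗ B, T ⊗ C)` is
represented by an étale `A`-algebra: `T ↦ Hom_T(T ⊗ B, T ⊗ C)` is represented by an algebra of
finite presentation, which inherits from `B` the infinitesimal lifting property, and isomorphisms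
are cut out by the invertibility of a determinant. For a finite free étale `R`-algebra `R'` and the
constant algebra with fibre `L ⊗ R'` at `t₀`, this shows that the fibres of `R'` at all `t` close to
`t₀` are isomorphic, so the field generated by the points of the fibre is locally constant.

The Galois group of that field acts faithfully on the points of the fibre, so its order is at most
`d!`, where `d` is the local degree, which is bounded because `S` is quasi-compact. There are only
finitely many groups of bounded order, and a prescribed one occurs on an open set.
-/

open Polynomial TensorProduct Filter Topology

section StableSimpleRoots

/-- A topological field in which simple roots of polynomials are stable: polynomials `g` of
bounded degree with coefficients close to those of `f` have roots close to any simple root of `f`.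
Closeness is expressed by filters, since `L[X]` carries no topology. -/
def HasStableSimpleRoots (L : Type*) [Field L] [TopologicalSpace L] : Prop :=
  ∀ (f : L[X]) (a : L), f.IsRoot a → f.derivative.eval a ≠ 0 →
    ∀ (l : Filter L[X]) (n : ℕ), f.natDegree ≤ n → (∀ᶠ g in l, g.natDegree ≤ n) →
      (∀ k, Tendsto (fun g ↦ g.coeff k) l (𝓝 (f.coeff k))) →
        ∀ U ∈ 𝓝 a, ∀ᶠ g in l, ∃ z ∈ U, g.IsRoot z

theorem eval_eq_sum_fin_coeff {R : Type*} [CommSemiring R] {n : ℕ} {f : R[X]}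
    (hf : f.natDegree ≤ n) (z : R) : f.eval z = ∑ i : Fin (n + 1), f.coeff i * z ^ (i : ℕ) := by
  rw [eval_eq_sum_range' (Nat.lt_succ_of_le hf), Finset.sum_range]

theorem isInvertible_of_apply_one_ne_zero {L : Type*} [NontriviallyNormedField L]
    (φ : L →L[L] L) (h : φ 1 ≠ 0) : φ.IsInvertible :=
  ⟨ContinuousLinearEquiv.unitsEquivAut L (Units.mk0 _ h), by ext; simp⟩

theorem HasStableSimpleRoots.of_completeSpace {L : Type*} [NontriviallyNormedField L]
    [CompleteSpace L] : HasStableSimpleRoots L := by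
  intro f a ha ha' l n hfn hln hl U hU
  let F : (Fin (n + 1) → L) × L → L := fun q ↦ ∑ i, q.1 i * q.2 ^ (i : ℕ)
  let coeffs (g : L[X]) : Fin (n + 1) → L := fun i ↦ g.coeff i
  have F_coeffs {g : L[X]} (hg : g.natDegree ≤ n) (z : L) : F (coeffs g, z) = g.eval z :=
    (eval_eq_sum_fin_coeff hg z).symm
  have hF : HasStrictFDerivAt F (fderiv L F (coeffs f, a)) (coeffs f, a) :=
    AnalyticAt.hasStrictFDerivAt (ContDiff.contDiffAt (by fun_prop)).analyticAt
  have hFz : (fderiv L F (coeffs f, a) ∘L .inr L _ _).IsInvertible := by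
    have h : HasDerivAt (fun z ↦ f.eval z) (fderiv L F (coeffs f, a) (0, 1)) a := by
      simp only [← F_coeffs hfn]
      exact hF.hasFDerivAt.comp_hasDerivAt a ((hasDerivAt_const a _).prodMk (hasDerivAt_id a))
    refine isInvertible_of_apply_one_ne_zero _ ?_
    rwa [ContinuousLinearMap.comp_apply, ContinuousLinearMap.inr_apply, h.unique (f.hasDerivAt a)]
  have hcoeffs : Tendsto coeffs l (𝓝 (coeffs f)) := tendsto_pi_nhds.mpr fun i ↦ hl i
  filter_upwards [hln, hcoeffs.eventually (hF.eventually_apply_implicitFunctionOfProdDomain hFz),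
    hcoeffs.eventually ((hF.tendsto_implicitFunctionOfProdDomain hFz).eventually hU)]
    with g hgn hg hgU
  exact ⟨_, hgU, by rw [IsRoot, ← F_coeffs hgn, hg, F_coeffs hfn, ha]⟩

section HenselianLocalRing

open IsLocalRing

variable {R : Type*} [CommRing R]

theorem exists_isRoot_one_sub_X_add [HenselianLocalRing R] {e : R} (he : e ∈ maximalIdeal R)
    (r : R[X]) : ∃ y, (1 - X + C e * X ^ 2 * r).IsRoot y := by
  set m := r.natDegree with hm
  -- The substitution `y = v⁻¹` turns `1 - y + e y² r(y)` into the monic polynomial `h` in `v`.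
  let h : R[X] := X ^ (m + 2) + (C e * r.reverse - X ^ (m + 1))
  have hdeg : (C e * r.reverse - X ^ (m + 1)).natDegree ≤ m + 1 := by
    refine (natDegree_sub_le _ _).trans (max_le ?_ (natDegree_X_pow_le _))
    exact (natDegree_C_mul_le _ _).trans ((reverse_natDegree_le r).trans m.le_succ)
  have hmonic : h.Monic := monic_X_pow_add
    ((degree_le_of_natDegree_le hdeg).trans_lt (by exact_mod_cast Nat.lt_succ_self _))
  have h_one : h.eval 1 ∈ maximalIdeal R := by
    simpa [h] using Ideal.mul_mem_right _ _ he
  have h'_one : IsUnit (h.derivative.eval 1) := by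
    have hmem : e * r.reverse.derivative.eval 1 ∈ maximalIdeal R := Ideal.mul_mem_right _ _ he
    have : h.derivative.eval 1 = 1 - -(e * r.reverse.derivative.eval 1) := by
      simp [h]; ring
    rw [this]
    exact isUnit_one_sub_self_of_mem_nonunits _ (neg_mem hmem)
  obtain ⟨v, hv, hv_one⟩ := HenselianLocalRing.is_henselian h hmonic 1 h_one h'_one
  obtain ⟨w, rfl⟩ : IsUnit v := by
    simpa using isUnit_one_sub_self_of_mem_nonunits _ (neg_mem hv_one)
  refine ⟨↑w⁻¹, ?_⟩
  have hr : r.reverse.eval ↑w * (↑w⁻¹ : R) ^ m = r.eval ↑w⁻¹ := by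
    have : Invertible (↑w⁻¹ : R) := w⁻¹.invertible
    simpa [eval₂_id, ← hm] using eval₂_reverse_mul_pow (RingHom.id R) (↑w⁻¹ : R) r
  have hv' : (w : R) ^ (m + 2) + (e * r.reverse.eval ↑w - (w : R) ^ (m + 1)) = 0 := by
    simpa [h] using hv
  have hw (k : ℕ) : (w : R) ^ k * (↑w⁻¹ : R) ^ k = 1 := by simp [← mul_pow]
  simp only [IsRoot, eval_add, eval_sub, eval_one, eval_X, eval_mul, eval_C, eval_pow, ← hr]
  linear_combination (↑w⁻¹ : R) ^ (m + 2) * hv' - hw (m + 2) + (↑w⁻¹ : R) * hw (m + 1)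

theorem exists_isRoot_mem_maximalIdeal [HenselianLocalRing R] {p : R[X]}
    (h₀ : p.coeff 0 ∈ maximalIdeal R) (h₁ : IsUnit (p.coeff 1)) :
    ∃ x ∈ maximalIdeal R, p.IsRoot x := by
  obtain ⟨b, hb⟩ := h₁
  set c := p.coeff 0 with hc
  set c' : R := c * ↑b⁻¹
  have hc' : c' ∈ maximalIdeal R := Ideal.mul_mem_right _ _ h₀
  -- Substitute `x = -c' y` and divide by the constant coefficient `c` of `p`.
  obtain ⟨y, hy⟩ := exists_isRoot_one_sub_X_add (Ideal.mul_mem_right (↑b⁻¹ : R) _ hc')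
    (p.divX.divX.comp (-(C c' * X)))
  refine ⟨-(c' * y), neg_mem (Ideal.mul_mem_right _ _ hc'), ?_⟩
  have hp : p = (p.divX.divX * X + C (b : R)) * X + C c := by
    rw [hb, hc, ← zero_add 1, ← coeff_divX, divX_mul_X_add, divX_mul_X_add]
  have hbb : (b : R) * ↑b⁻¹ = 1 := by simp
  have hy' : 1 - y + c' * ↑b⁻¹ * y ^ 2 * p.divX.divX.eval (-(c' * y)) = 0 := by simpa using hy
  rw [hp]
  simp only [IsRoot, eval_add, eval_mul, eval_X, eval_C]
  linear_combination c * hy' - c * y * hbb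

end HenselianLocalRing

theorem tendsto_eval_of_tendsto_coeff {R ι : Type*} [CommSemiring R] [TopologicalSpace R]
    [IsTopologicalSemiring R] {l : Filter ι} {n : ℕ} {G : ι → R[X]} {g : R[X]} {z : ι → R} {a : R}
    (hg : g.natDegree ≤ n) (hGn : ∀ᶠ i in l, (G i).natDegree ≤ n)
    (hG : ∀ k, Tendsto (fun i ↦ (G i).coeff k) l (𝓝 (g.coeff k))) (hz : Tendsto z l (𝓝 a)) :
    Tendsto (fun i ↦ (G i).eval (z i)) l (𝓝 (g.eval a)) := by
  rw [eval_eq_sum_range' (Nat.lt_succ_of_le hg)]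
  refine (tendsto_finsetSum _ fun k _ ↦ (hG k).mul (hz.pow k)).congr' ?_
  filter_upwards [hGn] with i hi using (eval_eq_sum_range' (Nat.lt_succ_of_le hi) _).symm

theorem tendsto_coeff_taylor {R : Type*} [CommSemiring R] [TopologicalSpace R]
    [IsTopologicalSemiring R] {l : Filter R[X]} {n : ℕ} {f : R[X]}
    (hf : f.natDegree ≤ n) (hn : ∀ᶠ g in l, g.natDegree ≤ n)
    (hl : ∀ k, Tendsto (fun g ↦ g.coeff k) l (𝓝 (f.coeff k))) (a : R) (k : ℕ) :
    Tendsto (fun g ↦ (taylor a g).coeff k) l (𝓝 ((taylor a f).coeff k)) := by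
  simp only [taylor_coeff]
  have natDegree_le {g : R[X]} (hg : g.natDegree ≤ n) : (hasseDeriv k g).natDegree ≤ n :=
    (natDegree_hasseDeriv_le g k).trans ((Nat.sub_le _ _).trans hg)
  refine tendsto_eval_of_tendsto_coeff (natDegree_le hf) (hn.mono fun g ↦ natDegree_le)
    (fun j ↦ ?_) tendsto_const_nhds
  simpa only [hasseDeriv_coeff] using (hl (j + k)).const_mul _

theorem exists_norm_lt_forall_norm_coeff_mul_pow_lt {L : Type*}
    [NontriviallyNormedField L] (f : L[X]) {ε δ : ℝ} (hε : 0 < ε) (hδ : 0 < δ) :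
    ∃ c : L, c ≠ 0 ∧ ‖c‖ < ε ∧ ∀ k, ‖f.coeff (k + 2) * c ^ (k + 1)‖ < δ := by
  have hk (k : ℕ) : ∀ᶠ c : L in 𝓝 0, ‖f.coeff (k + 2) * c ^ (k + 1)‖ < δ :=
    Continuous.tendsto' (by fun_prop) 0 0 (by simp) |>.eventually_lt_const hδ
  have hlt : ∀ᶠ c : L in 𝓝 0, ‖c‖ < ε :=
    Continuous.tendsto' continuous_norm 0 0 norm_zero |>.eventually_lt_const hε
  have hall : ∀ᶠ c : L in 𝓝 0, ∀ k ∈ Finset.range f.natDegree,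
      ‖f.coeff (k + 2) * c ^ (k + 1)‖ < δ := (Finset.eventually_all _).mpr fun k _ ↦ hk k
  obtain ⟨c, ⟨hc, hcε⟩, hc₀⟩ := ((hall.and hlt).filter_mono nhdsWithin_le_nhds).and
    (eventually_mem_nhdsWithin (a := (0 : L)) (s := {0}ᶜ)) |>.exists
  refine ⟨c, hc₀, hcε, fun k ↦ ?_⟩
  by_cases hkf : k < f.natDegree
  · exact hc k (Finset.mem_range.mpr hkf)
  · simpa [coeff_eq_zero_of_natDegree_lt (show f.natDegree < k + 2 by lia)] using hδ

section IsUltrametricDist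

open IsLocalRing

variable {L : Type*} [NontriviallyNormedField L] [IsUltrametricDist L]

theorem mem_integer_valuation_iff {x : L} :
    x ∈ (NormedField.valuation (K := L)).integer ↔ ‖x‖ ≤ 1 := by
  rw [Valuation.mem_integer_iff, NormedField.valuation_apply, ← NNReal.coe_le_coe]
  simp

theorem isUnit_integer_iff_norm_eq_one {x : (NormedField.valuation (K := L)).integer} :
    IsUnit x ↔ ‖(x : L)‖ = 1 := by
  rw [(Valuation.integer.integers _).isUnit_iff_valuation_eq_one, ← coe_nnnorm, NNReal.coe_eq_one]
  rfl

theorem exists_isRoot_of_norm_coeff [HenselianLocalRing (NormedField.valuation (K := L)).integer]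
    {h : L[X]} (h_le : ∀ k, ‖h.coeff k‖ ≤ 1) (h_zero : ‖h.coeff 0‖ < 1) (h_one : ‖h.coeff 1‖ = 1) :
    ∃ x, ‖x‖ ≤ 1 ∧ h.IsRoot x := by
  have hcoeffs : ↑h.coeffs ⊆ ((NormedField.valuation (K := L)).integer : Set L) := fun c hc ↦ by
    obtain ⟨k, -, rfl⟩ := mem_coeffs_iff.mp hc
    exact mem_integer_valuation_iff.mpr (h_le k)
  obtain ⟨x, -, hx⟩ := exists_isRoot_mem_maximalIdeal (p := h.toSubring _ hcoeffs)
    (by simpa [mem_maximalIdeal, isUnit_integer_iff_norm_eq_one] using h_zero.ne)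
    (by simpa [isUnit_integer_iff_norm_eq_one] using h_one)
  refine ⟨x, mem_integer_valuation_iff.mp x.2, ?_⟩
  rw [← map_toSubring h _ hcoeffs]
  exact hx.map

theorem exists_isRoot_norm_le [HenselianLocalRing (NormedField.valuation (K := L)).integer]
    {h : L[X]} {c : L} (h_zero : ‖h.coeff 0‖ < ‖h.coeff 1 * c‖)
    (h_two : ∀ k, ‖h.coeff (k + 2) * c ^ (k + 1)‖ ≤ ‖h.coeff 1‖) :
    ∃ x, ‖x‖ ≤ ‖c‖ ∧ h.IsRoot x := by
  have hne : h.coeff 1 * c ≠ 0 := norm_pos_iff.mp ((norm_nonneg _).trans_lt h_zero)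
  obtain ⟨hb, hc⟩ := mul_ne_zero_iff.mp hne
  let r : L[X] := C (h.coeff 1 * c)⁻¹ * h.comp (C c * X)
  have coeff_r (k : ℕ) : r.coeff k = h.coeff k * c ^ k / (h.coeff 1 * c) := by
    rw [coeff_C_mul, comp_C_mul_X_coeff, inv_mul_eq_div]
  have r_zero : ‖r.coeff 0‖ < 1 := by
    rw [coeff_r, pow_zero, mul_one, norm_div]
    exact (div_lt_one (norm_pos_iff.mpr hne)).mpr h_zero
  have r_one : ‖r.coeff 1‖ = 1 := by rw [coeff_r, pow_one, div_self hne, norm_one]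
  have r_two (k : ℕ) : ‖r.coeff (k + 2)‖ ≤ 1 := by
    rw [coeff_r, pow_succ, ← mul_assoc, mul_div_mul_right _ _ hc, norm_div]
    exact div_le_one_of_le₀ (h_two k) (norm_nonneg _)
  obtain ⟨x, hx, hx_root⟩ :=
    exists_isRoot_of_norm_coeff (by rintro (_ | _ | k); exacts [r_zero.le, r_one.le, r_two k])
      r_zero r_one
  refine ⟨c * x, ?_, by simpa [r, hb, hc] using hx_root⟩
  rw [norm_mul]
  exact mul_le_of_le_one_right (norm_nonneg c) hx

theorem HasStableSimpleRoots.of_henselianLocalRing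
    [HenselianLocalRing (NormedField.valuation (K := L)).integer] : HasStableSimpleRoots L := by
  intro f a ha ha' l n hfn hln hl U hU
  obtain ⟨ε, hε, hεU⟩ := Metric.mem_nhds_iff.mp hU
  have hf₁ : (taylor a f).coeff 1 ≠ 0 := by rwa [taylor_coeff_one]
  obtain ⟨c, hc₀, hcε, hc⟩ :=
    exists_norm_lt_forall_norm_coeff_mul_pow_lt (taylor a f) hε (norm_pos_iff.mpr hf₁)
  have hl' := tendsto_coeff_taylor hfn hln hl a
  have h_zero : ∀ᶠ g in l, ‖(taylor a g).coeff 0‖ < ‖(taylor a g).coeff 1 * c‖ :=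
    (hl' 0).norm.eventually_lt ((hl' 1).mul_const c).norm (by
      simpa [ha.eq_zero, taylor_coeff_one, hc₀] using ha')
  have h_two : ∀ᶠ g in l, ∀ k ∈ Finset.range n,
      ‖(taylor a g).coeff (k + 2) * c ^ (k + 1)‖ < ‖(taylor a g).coeff 1‖ :=
    (Finset.eventually_all _).mpr fun k _ ↦
      ((hl' (k + 2)).mul_const _).norm.eventually_lt (hl' 1).norm (hc k)
  filter_upwards [hln, h_zero, h_two] with g hgn hg₀ hg₂
  obtain ⟨x, hx, hx_root⟩ := exists_isRoot_norm_le hg₀ fun k ↦ by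
    by_cases hk : k < n
    · exact (hg₂ k (Finset.mem_range.mpr hk)).le
    · simp [coeff_eq_zero_of_natDegree_lt (show (taylor a g).natDegree < k + 2 by
        rw [natDegree_taylor]; lia)]
  refine ⟨x + a, hεU ?_, by rwa [IsRoot, taylor_eval] at hx_root⟩
  rw [mem_ball_iff_norm, add_sub_cancel_right]
  exact hx.trans_lt hcε

end IsUltrametricDist

theorem IsLocalField.hasStableSimpleRoots {L : Type u} [NontriviallyNormedField L]
    (hL : IsLocalField L) : HasStableSimpleRoots L := by
  obtain _ | ⟨_, -, _⟩ := hL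
  · have : ProperSpace L := .of_locallyCompactSpace L
    exact .of_completeSpace
  · exact .of_henselianLocalRing

end StableSimpleRoots

section LiftPoints

variable {L A Q ι : Type*} [Field L] [TopologicalSpace L] [IsTopologicalRing L] [T1Space L]
  [CommRing A] [CommRing Q] [Algebra A Q] {l : Filter ι} {τ : ι → A →+* L}

theorem eventually_forall_eval_map_ne_zero {τ₀ : A →+* L}
    (hτ : ∀ a, Tendsto (fun i ↦ τ i a) l (𝓝 (τ₀ a))) {g : A[X]} {x : L}
    (hx : (g.map τ₀).eval x ≠ 0) :
    ∃ U ∈ 𝓝 x, ∀ᶠ i in l, ∀ z ∈ U, (g.map (τ i)).eval z ≠ 0 := by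
  have h : Tendsto (fun q : ι × L ↦ (g.map (τ q.1)).eval q.2) (l ×ˢ 𝓝 x)
      (𝓝 ((g.map τ₀).eval x)) :=
    tendsto_eval_of_tendsto_coeff natDegree_map_le (.of_forall fun _ ↦ natDegree_map_le)
      (fun k ↦ by simpa only [coeff_map] using! (hτ (g.coeff k)).comp tendsto_fst) tendsto_snd
  obtain ⟨s, hs, U, hU, hne⟩ := eventually_prod_iff.mp (h.eventually_ne hx)
  exact ⟨{z | U z}, hU, hs.mono fun i hi z hz ↦ hne hi hz⟩

theorem HasStableSimpleRoots.eventually_exists_comp_algebraMap_eq_of_isStandardEtale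
    (hL : HasStableSimpleRoots L) [Algebra.IsStandardEtale A Q] (z₀ : Q →+* L)
    (hτ : ∀ a, Tendsto (fun i ↦ τ i a) l (𝓝 (z₀ (algebraMap A Q a)))) :
    ∀ᶠ i in l, ∃ z : Q →+* L, z.comp (algebraMap A Q) = τ i := by
  obtain ⟨P⟩ := Algebra.IsStandardEtale.nonempty_standardEtalePresentation (R := A) (S := Q)
  set x₀ := z₀ P.x
  have eval_x₀ (h : A[X]) : (h.map (z₀.comp (algebraMap A Q))).eval x₀ = z₀ (aeval P.x h) := by
    rw [Polynomial.eval_map, ← hom_eval₂, aeval_def]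
  obtain ⟨U, hU, hgU⟩ := eventually_forall_eval_map_ne_zero hτ (g := P.g) (x := x₀) (by
    rw [eval_x₀]; exact (P.hasMap.2.map z₀).ne_zero)
  have hroot : ∀ᶠ i in l, ∃ z ∈ U, (P.f.map (τ i)).IsRoot z := by
    refine hL (P.f.map (z₀.comp (algebraMap A Q))) x₀ ?_ ?_ (l.map fun i ↦ P.f.map (τ i))
      P.f.natDegree natDegree_map_le (eventually_map.mpr (.of_forall fun _ ↦ natDegree_map_le))
      (fun k ↦ ?_) U hU
    · rw [IsRoot, eval_x₀, P.hasMap.1, map_zero]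
    · rw [derivative_map, eval_x₀]
      exact (P.hasMap.isUnit_derivative_f.map z₀).ne_zero
    · simpa only [tendsto_map'_iff, Function.comp_def, coeff_map, RingHom.comp_apply] using
        hτ (P.f.coeff k)
  filter_upwards [hroot, hgU] with i ⟨z, hzU, hz⟩ hg
  let := (τ i).toAlgebra
  have hz' : P.HasMap z := ⟨by rwa [IsRoot, Polynomial.eval_map] at hz,
    by rw [isUnit_iff_ne_zero]; simpa only [Polynomial.eval_map] using! hg z hzU⟩
  exact ⟨((P.lift z hz').comp P.equivRing.toAlgHom : Q →ₐ[A] L), AlgHom.comp_algebraMap _⟩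

theorem HasStableSimpleRoots.eventually_exists_comp_algebraMap_eq
    (hL : HasStableSimpleRoots L) [Algebra.Etale A Q] (z₀ : Q →+* L)
    (hτ : ∀ a, Tendsto (fun i ↦ τ i a) l (𝓝 (z₀ (algebraMap A Q a)))) :
    ∀ᶠ i in l, ∃ z : Q →+* L, z.comp (algebraMap A Q) = τ i := by
  have := RingHom.ker_isPrime z₀
  obtain ⟨f, hf, hf_etale⟩ :=
    Algebra.IsEtaleAt.exists_isStandardEtale (R := A) (RingHom.ker z₀)
  let z₁ : Localization.Away f →+* L :=
    IsLocalization.Away.lift f (isUnit_iff_ne_zero.mpr (by rwa [RingHom.mem_ker] at hf))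
  have hz₁ : z₁.comp (algebraMap A (Localization.Away f)) = z₀.comp (algebraMap A Q) := by
    rw [IsScalarTower.algebraMap_eq A Q, ← RingHom.comp_assoc, IsLocalization.Away.lift_comp]
  filter_upwards [hL.eventually_exists_comp_algebraMap_eq_of_isStandardEtale z₁ (τ := τ)
    fun a ↦ by rw [← RingHom.comp_apply, hz₁]; exact hτ a] with i ⟨z, hz⟩
  refine ⟨z.comp (algebraMap Q _), ?_⟩
  rw [RingHom.comp_assoc, ← IsScalarTower.algebraMap_eq, hz]

end LiftPoints

section UniversalHom

variable {A B C Q : Type u} [CommRing A] [CommRing B] [CommRing C] [CommRing Q]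
  [Algebra A B] [Algebra A C] [Algebra A Q]

/-- `v` is the universal homomorphism from `B` to `C` after base change: `Q` represents the functor
`T ↦ Hom_T(T ⊗[A] B, T ⊗[A] C)`, written here as `T ↦ Hom_A(B, T ⊗[A] C)`, on the `A`-algebras in
the universe of `A`. -/
def IsUniversalHom (v : B →ₐ[A] Q ⊗[A] C) : Prop :=
  ∀ (T : Type u) [CommRing T] [Algebra A T],
    Function.Bijective fun z : Q →ₐ[A] T ↦ (Algebra.TensorProduct.map z (.id A C)).comp v

theorem basis_repr_map_id {κ T : Type*} [CommRing T] [Algebra A T] (c : Module.Basis κ A C)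
    (z : Q →ₐ[A] T) (x : Q ⊗[A] C) (j : κ) :
    (Algebra.TensorProduct.basis T c).repr (Algebra.TensorProduct.map z (.id A C) x) j =
      z ((Algebra.TensorProduct.basis Q c).repr x j) := by
  induction x with
  | zero => simp only [map_zero, Finsupp.zero_apply]
  | add x y hx hy => simp only [map_add, Finsupp.add_apply, hx, hy]
  | tmul q a => simp [Algebra.TensorProduct.basis_repr_tmul]

theorem exists_isUniversalHom_mvPolynomial {κ σ : Type u} [Finite κ] (c : Module.Basis κ A C) :
    ∃ v : MvPolynomial σ A →ₐ[A] MvPolynomial (σ × κ) A ⊗[A] C, IsUniversalHom v := by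
  classical
  have := Fintype.ofFinite κ
  have map_v {T : Type u} [CommRing T] [Algebra A T] (z : MvPolynomial (σ × κ) A →ₐ[A] T) (i : σ) :
      (Algebra.TensorProduct.map z (.id A C)) (∑ j, MvPolynomial.X (i, j) ⊗ₜ c j) =
        ∑ j, z (.X (i, j)) • Algebra.TensorProduct.basis T c j := by
    simp [TensorProduct.smul_tmul']
  refine ⟨MvPolynomial.aeval fun i ↦ ∑ j, MvPolynomial.X (i, j) ⊗ₜ c j,
    fun T _ _ ↦ ⟨fun z z' h ↦ ?_, fun φ ↦ ?_⟩⟩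
  · refine MvPolynomial.algHom_ext fun ⟨i, j⟩ ↦ ?_
    have hi := DFunLike.congr_fun h (MvPolynomial.X i)
    simp only [AlgHom.comp_apply, MvPolynomial.aeval_X, map_v] at hi
    simpa [Finsupp.single_apply] using congr((Algebra.TensorProduct.basis T c).repr $hi j)
  · refine ⟨MvPolynomial.aeval fun p ↦
      (Algebra.TensorProduct.basis T c).repr (φ (MvPolynomial.X p.1)) p.2,
      MvPolynomial.algHom_ext fun i ↦ ?_⟩
    simp only [AlgHom.comp_apply, MvPolynomial.aeval_X, map_v, Module.Basis.sum_repr]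

theorem basis_repr_eq_zero_iff_map_mk {κ : Type*} (c : Module.Basis κ A C) (I : Ideal Q)
    (x : Q ⊗[A] C) :
    Algebra.TensorProduct.map (Ideal.Quotient.mkₐ A I) (.id A C) x = 0 ↔
      ∀ j, (Algebra.TensorProduct.basis Q c).repr x j ∈ I := by
  rw [← (Algebra.TensorProduct.basis (Q ⧸ I) c).repr.map_eq_zero_iff, Finsupp.ext_iff]
  simp only [basis_repr_map_id, Ideal.Quotient.mkₐ_eq_mk, Finsupp.zero_apply,
    Ideal.Quotient.eq_zero_iff_mem]

theorem IsUniversalHom.exists_of_surjective {P : Type u} [CommRing P] [Algebra A P]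
    {κ : Type*} [Finite κ] (c : Module.Basis κ A C)
    {v : P →ₐ[A] Q ⊗[A] C} (hv : IsUniversalHom v) {π : P →ₐ[A] B} (hπ : Function.Surjective π)
    (hker : (RingHom.ker π).FG) :
    ∃ I : Ideal Q, I.FG ∧ ∃ w : B →ₐ[A] (Q ⧸ I) ⊗[A] C, IsUniversalHom w := by
  obtain ⟨s, hs⟩ := hker
  let coord (F : P) (j : κ) : Q := (Algebra.TensorProduct.basis Q c).repr (v F) j
  let I : Ideal Q := .span (Set.image2 coord s Set.univ)
  let mkI := Algebra.TensorProduct.map (Ideal.Quotient.mkₐ A I) (.id A C)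
  have ker_le : RingHom.ker π ≤ RingHom.ker (mkI.comp v) := by
    rw [← hs, Ideal.span_le]
    exact fun F hF ↦ (basis_repr_eq_zero_iff_map_mk c I (v F)).mpr fun j ↦
      Ideal.subset_span ⟨F, hF, j, trivial, rfl⟩
  obtain ⟨w, hw⟩ : ∃ w : B →ₐ[A] (Q ⧸ I) ⊗[A] C, w.comp π = mkI.comp v :=
    ⟨_, AlgHom.liftOfSurjective_comp π hπ (mkI.comp v) ker_le⟩
  have map_w {T : Type u} [CommRing T] [Algebra A T] (z : Q ⧸ I →ₐ[A] T) :
      ((Algebra.TensorProduct.map z (.id A C)).comp w).comp π =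
        (Algebra.TensorProduct.map (z.comp (Ideal.Quotient.mkₐ A I)) (.id A C)).comp v := by
    rw [AlgHom.comp_assoc, hw, ← AlgHom.comp_assoc,
      ← Algebra.TensorProduct.map_comp, AlgHom.comp_id]
  refine ⟨I, Submodule.fg_span (s.finite_toSet.image2 _ Set.finite_univ), w,
    fun T _ _ ↦ ⟨fun z z' h ↦ ?_, fun φ ↦ ?_⟩⟩
  · refine Ideal.Quotient.algHom_ext _ ((hv T).injective ?_)
    simp only [← map_w]
    exact congr(AlgHom.comp $h π)
  · obtain ⟨z, hz⟩ := (hv T).surjective (φ.comp π)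
    have I_le : I ≤ RingHom.ker z := by
      rw [Ideal.span_le]
      rintro _ ⟨F, hF, j, -, rfl⟩
      have hF' : π F = 0 := hs.le (Ideal.subset_span hF)
      have := DFunLike.congr_fun hz F
      simp only [AlgHom.comp_apply, hF', map_zero] at this
      rw [SetLike.mem_coe, RingHom.mem_ker, ← basis_repr_map_id, this, map_zero,
        Finsupp.zero_apply]
    refine ⟨Ideal.Quotient.liftₐ I z I_le, ?_⟩
    dsimp only
    rw [← AlgHom.cancel_right hπ, map_w, ← hz]
    congr

theorem exists_finitePresentation_isUniversalHom [Algebra.FinitePresentation A B]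
    [Module.Free A C] [Module.Finite A C] :
    ∃ (Q : Type u) (_ : CommRing Q) (_ : Algebra A Q) (v : B →ₐ[A] Q ⊗[A] C),
      Algebra.FinitePresentation A Q ∧ IsUniversalHom v := by
  obtain ⟨σ, _, π, hπ, hker⟩ := Algebra.FinitePresentation.iff_quotient_mvPolynomial'.mp
    ‹Algebra.FinitePresentation A B›
  let c := Module.Free.chooseBasis A C
  obtain ⟨v, hv⟩ := exists_isUniversalHom_mvPolynomial (σ := σ) c
  obtain ⟨I, hI, w, hw⟩ := hv.exists_of_surjective c hπ hker
  exact ⟨_, _, _, w, .quotient hI, hw⟩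

theorem ker_map_mk_sq {T : Type*} [CommRing T] [Algebra A T] {I : Ideal T} (hI : I ^ 2 = ⊥) :
    RingHom.ker (Algebra.TensorProduct.map (Ideal.Quotient.mkₐ A I) (.id A C)) ^ 2 = ⊥ := by
  rw [Algebra.TensorProduct.rTensor_ker _ (Ideal.Quotient.mkₐ_surjective A I),
    ← Ideal.map_pow, show RingHom.ker (Ideal.Quotient.mkₐ A I) = I from
      Ideal.Quotient.mkₐ_ker A I, hI, Ideal.map_bot]

theorem IsUniversalHom.formallyEtale [Algebra.FormallyEtale A B] {v : B →ₐ[A] Q ⊗[A] C}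
    (hv : IsUniversalHom v) : Algebra.FormallyEtale A Q := by
  refine Algebra.FormallyEtale.iff_comp_bijective.mpr fun T _ _ I hI ↦ ?_
  let mkI := Algebra.TensorProduct.map (Ideal.Quotient.mkₐ A I) (.id A C)
  have mkI_surj : Function.Surjective mkI :=
    Algebra.TensorProduct.map_surjective _ _ (Ideal.Quotient.mkₐ_surjective A I)
      Function.surjective_id
  have map_mkI (z : Q →ₐ[A] T) :
      (Algebra.TensorProduct.map ((Ideal.Quotient.mkₐ A I).comp z) (.id A C)).comp v =
        mkI.comp ((Algebra.TensorProduct.map z (.id A C)).comp v) := by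
    rw [← AlgHom.comp_assoc, ← Algebra.TensorProduct.map_comp, AlgHom.comp_id]
  have nil : IsNilpotent (RingHom.ker mkI) := ⟨2, ker_map_mk_sq hI⟩
  refine ⟨fun z z' h ↦ (hv T).injective ?_, fun z ↦ ?_⟩
  · refine Algebra.FormallyUnramified.lift_unique' mkI nil _ _ ?_
    simp only [← map_mkI]
    exact congr((Algebra.TensorProduct.map $h (.id A C)).comp v)
  · let φ := Algebra.FormallySmooth.liftOfSurjective
      ((Algebra.TensorProduct.map z (.id A C)).comp v) mkI mkI_surj nil
    obtain ⟨y, hy⟩ := (hv T).surjective φ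
    refine ⟨y, (hv _).injective ?_⟩
    dsimp only at hy ⊢
    rw [map_mkI, hy]
    exact Algebra.FormallySmooth.comp_liftOfSurjective _ _ mkI_surj nil

/-- The homomorphism of `T`-algebras `T ⊗[A] B → T ⊗[A] C` induced by `φ : B → T ⊗[A] C`; it
identifies the two descriptions of the functor in `IsUniversalHom`. -/
noncomputable def extendScalars {T : Type*} [CommRing T] [Algebra A T] (φ : B →ₐ[A] T ⊗[A] C) :
    T ⊗[A] B →ₐ[T] T ⊗[A] C :=
  Algebra.TensorProduct.lift (Algebra.ofId T _) φ fun _ _ ↦ .all _ _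

theorem extendScalars_one_tmul {T : Type*} [CommRing T] [Algebra A T] (φ : B →ₐ[A] T ⊗[A] C)
    (x : B) : extendScalars φ (1 ⊗ₜ x) = φ x := by
  rw [extendScalars, Algebra.TensorProduct.lift_tmul, map_one, one_mul]

theorem extendScalars_comp_includeRight {T : Type*} [CommRing T] [Algebra A T]
    (e : T ⊗[A] B →ₐ[T] T ⊗[A] C) :
    extendScalars ((e.restrictScalars A).comp Algebra.TensorProduct.includeRight) = e := by
  ext x
  exact extendScalars_one_tmul _ x

theorem bijective_iff_isUnit_det_toMatrix {T M N ι : Type*} [CommRing T] [AddCommGroup M]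
    [AddCommGroup N] [Module T M] [Module T N] [Fintype ι] [DecidableEq ι] (b : Module.Basis ι T M)
    (c : Module.Basis ι T N) (f : M →ₗ[T] N) :
    Function.Bijective f ↔ IsUnit (LinearMap.toMatrix b c f).det :=
  ⟨fun hf ↦ (LinearEquiv.ofBijective f hf).isUnit_det b c,
    fun h ↦ (LinearEquiv.ofIsUnitDet h).bijective⟩

theorem toMatrix_extendScalars {ι T : Type*} [Fintype ι] [DecidableEq ι] [CommRing T] [Algebra A T]
    (b : Module.Basis ι A B) (c : Module.Basis ι A C) (v : B →ₐ[A] Q ⊗[A] C) (z : Q →ₐ[A] T) :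
    LinearMap.toMatrix (Algebra.TensorProduct.basis T b) (Algebra.TensorProduct.basis T c)
      (extendScalars ((Algebra.TensorProduct.map z (.id A C)).comp v)).toLinearMap =
    (LinearMap.toMatrix (Algebra.TensorProduct.basis Q b) (Algebra.TensorProduct.basis Q c)
      (extendScalars v).toLinearMap).map z := by
  ext i j
  simp [LinearMap.toMatrix_apply, extendScalars_one_tmul, basis_repr_map_id]

theorem exists_isUnit_iff_bijective (v : B →ₐ[A] Q ⊗[A] C) {ι : Type*}
    [Finite ι] (b : Module.Basis ι A B) (c : Module.Basis ι A C) :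
    ∃ δ : Q, ∀ (T : Type u) [CommRing T] [Algebra A T] (z : Q →ₐ[A] T), IsUnit (z δ) ↔
      Function.Bijective (extendScalars ((Algebra.TensorProduct.map z (.id A C)).comp v)) := by
  classical
  have := Fintype.ofFinite ι
  refine ⟨(LinearMap.toMatrix (Algebra.TensorProduct.basis Q b) (Algebra.TensorProduct.basis Q c)
    (extendScalars v).toLinearMap).det, fun T _ _ z ↦ ?_⟩
  rw [AlgHom.map_det, AlgHom.mapMatrix_apply, ← toMatrix_extendScalars,
    ← bijective_iff_isUnit_det_toMatrix]
  rfl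

theorem exists_etale_nonempty_algHom_iff_nonempty_algEquiv [Algebra.Etale A B] {ι : Type*}
    [Finite ι] (b : Module.Basis ι A B) (c : Module.Basis ι A C) :
    ∃ (I : Type u) (_ : CommRing I) (_ : Algebra A I), Algebra.Etale A I ∧
      ∀ (T : Type u) [CommRing T] [Algebra A T],
        Nonempty (I →ₐ[A] T) ↔ Nonempty (T ⊗[A] B ≃ₐ[T] T ⊗[A] C) := by
  have := Module.Free.of_basis c
  have := Module.Finite.of_basis c
  obtain ⟨Q, _, _, v, _, hv⟩ := exists_finitePresentation_isUniversalHom (A := A) (B := B) (C := C)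
  have := hv.formallyEtale
  have : Algebra.Etale A Q := {}
  obtain ⟨δ, hδ⟩ := exists_isUnit_iff_bijective v b c
  refine ⟨Localization.Away δ, _, _, inferInstance, fun T _ _ ↦ ⟨fun ⟨z⟩ ↦ ⟨?_⟩, fun ⟨e⟩ ↦ ?_⟩⟩
  · exact AlgEquiv.ofBijective _ ((hδ T (z.comp (Algebra.algHom A Q _))).mp
      ((IsLocalization.Away.algebraMap_isUnit δ).map z))
  · obtain ⟨z, hz⟩ := (hv T).surjective
      ((e.toAlgHom.restrictScalars A).comp Algebra.TensorProduct.includeRight)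
    dsimp only at hz
    have hzδ : IsUnit (z δ) := by
      rw [hδ, hz, extendScalars_comp_includeRight]
      exact e.bijective
    refine ⟨IsLocalization.liftAlgHom (M := Submonoid.powers δ) (f := z) ?_⟩
    rintro ⟨_, n, rfl⟩
    simpa only [map_pow] using hzδ.pow n

end UniversalHom

section PointsField

open IntermediateField

variable {R L R' : Type*} [CommRing R] [CommRing R'] [Algebra R R'] [Field L]

/-- The affine form of `fieldOfPoints` for the fibre of `Spec R' ⟶ Spec R` at the `L`-point `t`: the
subfield of `Ω` generated over `L` by the images of the `Ω`-points `ψ` of this fibre. -/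
def pointsField (t : R →+* L) (R' Ω : Type*) [CommRing R'] [Algebra R R'] [Field Ω] [Algebra L Ω] :
    IntermediateField L Ω :=
  adjoin L {x | ∃ ψ : R' →+* Ω,
    ψ.comp (algebraMap R R') = (algebraMap L Ω).comp t ∧ x ∈ Set.range ψ}

variable {Ω : Type*} [Field Ω] [Algebra L Ω] {t : R →+* L}

theorem apply_mem_pointsField {ψ : R' →+* Ω}
    (hψ : ψ.comp (algebraMap R R') = (algebraMap L Ω).comp t) (x : R') :
    ψ x ∈ pointsField t R' Ω :=
  subset_adjoin _ _ ⟨ψ, hψ, x, rfl⟩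

theorem pointsField_le_iff {F : IntermediateField L Ω} :
    pointsField t R' Ω ≤ F ↔ ∀ ψ : R' →+* Ω,
      ψ.comp (algebraMap R R') = (algebraMap L Ω).comp t → ∀ x, ψ x ∈ F :=
  adjoin_le_iff.trans ⟨fun h ψ hψ x ↦ h ⟨ψ, hψ, x, rfl⟩,
    by rintro h _ ⟨ψ, hψ, x, rfl⟩; exact h ψ hψ x⟩

theorem pointsField_congr {R'' : Type*} [CommRing R''] [Algebra R R''] (e : R' ≃ₐ[R] R'') :
    pointsField t R' Ω = pointsField t R'' Ω := by
  refine le_antisymm (pointsField_le_iff.mpr fun ψ hψ x ↦ ?_)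
    (pointsField_le_iff.mpr fun ψ hψ x ↦ ?_)
  · have hψ' : (ψ.comp (e.symm : R'' →+* R')).comp (algebraMap R R'') =
        (algebraMap L Ω).comp t := by
      rw [← hψ]; ext r; simp
    simpa using apply_mem_pointsField hψ' (e x)
  · have hψ' : (ψ.comp (e : R' →+* R'')).comp (algebraMap R R') = (algebraMap L Ω).comp t := by
      rw [← hψ]; ext r; simp
    simpa using apply_mem_pointsField hψ' (e.symm x)

theorem pointsField_tensorProduct {A : Type*} [CommRing A] [Algebra R A] (y : A →+* L) :
    pointsField y (A ⊗[R] R') Ω = pointsField (y.comp (algebraMap R A)) R' Ω := by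
  refine le_antisymm (pointsField_le_iff.mpr fun ψ hψ x ↦ ?_)
    (pointsField_le_iff.mpr fun ψ hψ x ↦ ?_)
  · have hψA (a : A) : ψ (a ⊗ₜ 1) = algebraMap L Ω (y a) := RingHom.congr_fun hψ a
    have hψ' : (ψ.comp (Algebra.TensorProduct.includeRight : R' →ₐ[R] A ⊗[R] R').toRingHom).comp
        (algebraMap R R') = (algebraMap L Ω).comp (y.comp (algebraMap R A)) := by
      rw [← RingHom.comp_assoc, ← hψ]
      ext r
      simp [Algebra.TensorProduct.algebraMap_apply]
    induction x with
    | zero => simp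
    | add x x' hx hx' => rw [map_add]; exact add_mem hx hx'
    | tmul a r =>
      rw [← mul_one a, ← one_mul r, ← Algebra.TensorProduct.tmul_mul_tmul, map_mul, hψA]
      exact mul_mem (IntermediateField.algebraMap_mem _ _) (apply_mem_pointsField hψ' r)
  · let := (ψ.comp (algebraMap R R')).toAlgebra
    let yΩ : A →ₐ[R] Ω := ⟨(algebraMap L Ω).comp y, fun r ↦ (RingHom.congr_fun hψ r).symm⟩
    let ψR : R' →ₐ[R] Ω := ⟨ψ, fun _ ↦ rfl⟩
    have h : ((Algebra.TensorProduct.productMap yΩ ψR : A ⊗[R] R' →ₐ[R] Ω) : A ⊗[R] R' →+* Ω).comp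
        (algebraMap A (A ⊗[R] R')) = (algebraMap L Ω).comp y := by
      ext a
      simp [Algebra.TensorProduct.algebraMap_apply, yΩ]
    simpa [ψR] using apply_mem_pointsField h (1 ⊗ₜ x)

theorem pointsField_eq_of_algEquiv {A B C : Type*} [CommRing A] [CommRing B] [CommRing C]
    [Algebra A L] [Algebra A B] [Algebra A C] (e : L ⊗[A] B ≃ₐ[L] L ⊗[A] C) :
    pointsField (algebraMap A L) B Ω = pointsField (algebraMap A L) C Ω := by
  simpa only [pointsField_tensorProduct, RingHom.id_comp] using
    pointsField_congr (t := RingHom.id L) (Ω := Ω) e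

end PointsField

section LocalConstancy

variable {L Ω : Type u} [Field L] [TopologicalSpace L] [IsTopologicalRing L] [T1Space L]
  [Field Ω] [Algebra L Ω] {κ : Type*} {l : Filter κ}

theorem HasStableSimpleRoots.eventually_pointsField_eq_of_algEquiv (hL : HasStableSimpleRoots L)
    {A B C ι : Type u} [CommRing A] [CommRing B] [CommRing C] [Algebra A L] [Algebra A B]
    [Algebra A C] [Algebra.Etale A B] [Finite ι] (b : Module.Basis ι A B) (c : Module.Basis ι A C)
    (e : L ⊗[A] B ≃ₐ[L] L ⊗[A] C) {y : κ → A →+* L}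
    (hy : ∀ a, Tendsto (y · a) l (𝓝 (algebraMap A L a))) :
    ∀ᶠ i in l, pointsField (y i) B Ω = pointsField (y i) C Ω := by
  obtain ⟨I, _, _, _, hI⟩ := exists_etale_nonempty_algHom_iff_nonempty_algEquiv b c
  obtain ⟨z₀⟩ := (hI L).mpr ⟨e⟩
  filter_upwards [hL.eventually_exists_comp_algebraMap_eq (z₀ : I →+* L) (τ := y)
    (by simpa using hy)] with i ⟨z, hz⟩
  let := (y i).toAlgebra
  obtain ⟨e⟩ := (hI L).mp ⟨⟨z, RingHom.congr_fun hz⟩⟩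
  exact pointsField_eq_of_algEquiv e

theorem HasStableSimpleRoots.eventually_pointsField_comp_algebraMap_eq (hL : HasStableSimpleRoots L)
    {A R R' ι : Type u} [CommRing A] [CommRing R] [CommRing R'] [Algebra L A] [Algebra R A]
    [Algebra R R'] [Algebra.Etale R R'] [Finite ι] (b : Module.Basis ι R R')
    {y₀ : A →+* L} {y : κ → A →+* L} (hy₀ : y₀.comp (algebraMap L A) = RingHom.id L)
    (hy : ∀ i, (y i).comp (algebraMap L A) = RingHom.id L)
    (h : ∀ a, Tendsto (y · a) l (𝓝 (y₀ a))) :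
    ∀ᶠ i in l, pointsField ((y i).comp (algebraMap R A)) R' Ω =
      pointsField (y₀.comp (algebraMap R A)) R' Ω := by
  let := y₀.toAlgebra
  let := (y₀.comp (algebraMap R A)).toAlgebra
  have : IsScalarTower L A L := .of_algebraMap_eq' hy₀.symm
  have : IsScalarTower R A L := .of_algebraMap_eq' rfl
  -- Over `A`, compare `A ⊗[R] R'` with the constant algebra whose fibre is that of `R'` at `y₀`.
  let e : L ⊗[A] (A ⊗[R] R') ≃ₐ[L] L ⊗[A] (A ⊗[L] (L ⊗[R] R')) :=
    (Algebra.TensorProduct.cancelBaseChange R A L L R').trans <|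
      ((Algebra.TensorProduct.cancelBaseChange L A L L _).trans
        (Algebra.TensorProduct.lid L _)).symm
  filter_upwards [hL.eventually_pointsField_eq_of_algEquiv (Ω := Ω) (b.baseChange A)
    ((b.baseChange L).baseChange A) e h] with i hi
  simpa only [pointsField_tensorProduct, hy, RingHom.id_comp] using! hi

theorem HasStableSimpleRoots.eventually_pointsField_eq (hL : HasStableSimpleRoots L)
    {R R' : Type u} [CommRing R] [CommRing R'] [Algebra R R'] [Algebra.Etale R R']
    [Module.Finite R R'] [Module.Free R R'] {t₀ : R →+* L} {t : κ → R →+* L}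
    (ht : ∀ a, Tendsto (t · a) l (𝓝 (t₀ a))) :
    ∀ᶠ i in l, pointsField (t i) R' Ω = pointsField t₀ R' Ω := by
  -- Ring homomorphisms `R → L` are the same as `L`-algebra homomorphisms `L ⊗[ℤ] R → L`.
  let : Algebra R (L ⊗[ℤ] R) := Algebra.TensorProduct.rightAlgebra
  let y (τ : R →+* L) : L ⊗[ℤ] R →+* L :=
    (Algebra.TensorProduct.productMap (AlgHom.id ℤ L) τ.toIntAlgHom).toRingHom
  have y_left (τ : R →+* L) : (y τ).comp (algebraMap L _) = RingHom.id L := by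
    ext x
    simp [y, Algebra.TensorProduct.algebraMap_apply]
  have y_right (τ : R →+* L) : (y τ).comp (algebraMap R _) = τ := by
    ext x
    simp [y, Algebra.TensorProduct.right_algebraMap_apply]
  have hy (a : L ⊗[ℤ] R) : Tendsto (fun i ↦ y (t i) a) l (𝓝 (y t₀ a)) := by
    induction a with
    | zero => simpa only [map_zero] using tendsto_const_nhds
    | add a a' ha ha' => simpa only [map_add] using ha.add ha'
    | tmul x r => simpa [y] using (ht r).const_mul x
  simpa only [y_right] using
    hL.eventually_pointsField_comp_algebraMap_eq (Ω := Ω) (Module.Free.chooseBasis R R')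
      (y_left t₀) (fun i ↦ y_left (t i)) hy

end LocalConstancy

section Galois

open IntermediateField

variable {L B Ω : Type*} [Field L] [CommRing B] [Algebra L B] [Field Ω] [Algebra L Ω]

theorem pointsField_id :
    pointsField (RingHom.id L) B Ω = adjoin L (⋃ ψ : B →ₐ[L] Ω, Set.range ψ) := by
  refine le_antisymm (pointsField_le_iff.mpr fun ψ hψ x ↦ ?_) (adjoin_le_iff.mpr ?_)
  · exact subset_adjoin _ _ (Set.mem_iUnion.mpr ⟨⟨ψ, RingHom.congr_fun hψ⟩, x, rfl⟩)
  · rintro _ ⟨_, ⟨ψ, rfl⟩, x, rfl⟩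
    exact apply_mem_pointsField ψ.comp_algebraMap x

theorem normal_pointsField_id [Normal L Ω] : Normal L (pointsField (RingHom.id L) B Ω) := by
  rw [normal_iff_forall_map_le]
  intro σ
  rw [IntermediateField.map_le_iff_le_comap, pointsField_le_iff]
  intro ψ hψ x
  refine apply_mem_pointsField (ψ := (σ : Ω →+* Ω).comp ψ) ?_ x
  rw [RingHom.comp_assoc, hψ, ← RingHom.comp_assoc, AlgHom.comp_algebraMap]

variable [Module.Finite L B]

theorem adjoin_range_toSubalgebra (ψ : B →ₐ[L] Ω) :
    (adjoin L (Set.range ψ)).toSubalgebra = ψ.range := by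
  rw [adjoin_toSubalgebra_of_isAlgebraic, ← ψ.coe_range, Algebra.adjoin_eq]
  rintro _ ⟨x, rfl⟩
  exact ((Algebra.IsIntegral.isIntegral (R := L) x).map ψ).isAlgebraic

theorem exists_surjective_algHom_adjoin_range (ψ : B →ₐ[L] Ω) :
    ∃ π : B →ₐ[L] adjoin L (Set.range ψ), Function.Surjective π := by
  refine ⟨ψ.codRestrict (adjoin L (Set.range ψ)).toSubalgebra
    fun x ↦ subset_adjoin _ _ ⟨x, rfl⟩, fun ⟨y, hy⟩ ↦ ?_⟩
  rw [← mem_toSubalgebra, adjoin_range_toSubalgebra] at hy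
  exact hy.imp fun x hx ↦ Subtype.ext hx

theorem finiteDimensional_pointsField_id :
    FiniteDimensional L (pointsField (RingHom.id L) B Ω) := by
  have (ψ : B →ₐ[L] Ω) : FiniteDimensional L (adjoin L (Set.range ψ)) := by
    obtain ⟨π, hπ⟩ := exists_surjective_algHom_adjoin_range ψ
    exact .of_surjective π.toLinearMap hπ
  rw [pointsField_id, adjoin_iUnion]
  infer_instance

theorem isSeparable_pointsField_id [Algebra.FormallyUnramified L B] :
    Algebra.IsSeparable L (pointsField (RingHom.id L) B Ω) := by
  have (ψ : B →ₐ[L] Ω) : Algebra.IsSeparable L (adjoin L (Set.range ψ)) := by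
    obtain ⟨π, hπ⟩ := exists_surjective_algHom_adjoin_range ψ
    have : Algebra.FormallyUnramified L (adjoin L (Set.range ψ)) := .of_surjective π hπ
    have : Module.Finite L (adjoin L (Set.range ψ)) := .of_surjective π.toLinearMap hπ
    exact Algebra.FormallyUnramified.isSeparable L _
  rw [pointsField_id, adjoin_iUnion]
  infer_instance

theorem card_algEquiv_pointsField_id_le :
    Nat.card (pointsField (RingHom.id L) B Ω ≃ₐ[L] pointsField (RingHom.id L) B Ω) ≤
      (Module.finrank L B).factorial := by
  set F := pointsField (RingHom.id L) B Ω
  let permute (σ : F ≃ₐ[L] F) : Equiv.Perm (B →ₐ[L] F) := AlgEquiv.refl.arrowCongr σ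
  have permute_injective : Function.Injective permute := by
    intro σ σ' h
    refine AlgEquiv.coe_toAlgHom_injective (algHom_ext_of_eq_adjoin L (K := F) (S := F) rfl ?_)
    rintro _ ⟨ψ, hψ, x, rfl⟩
    let ψF : B →ₐ[L] F :=
      (⟨ψ, RingHom.congr_fun hψ⟩ : B →ₐ[L] Ω).codRestrict F.toSubalgebra (apply_mem_pointsField hψ)
    exact DFunLike.congr_fun (DFunLike.congr_fun h ψF) x
  have := Finite.of_injective permute permute_injective
  calc _ ≤ Nat.card (Equiv.Perm (B →ₐ[L] F)) := Nat.card_le_card_of_injective _ permute_injective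
    _ = (Nat.card (B →ₐ[L] F)).factorial := Nat.card_perm
    _ ≤ _ := Nat.factorial_le (card_algHom_le_finrank L B F)

end Galois

section GaloisFibre

variable {R L R' Ω : Type*} [CommRing R] [CommRing R'] [Algebra R R'] [Field L] [Algebra R L]
  [Field Ω] [Algebra L Ω]

theorem pointsField_eq_pointsField_id :
    pointsField (algebraMap R L) R' Ω = pointsField (RingHom.id L) (L ⊗[R] R') Ω :=
  (pointsField_tensorProduct (RingHom.id L)).symm

variable [Module.Finite R R']

theorem finiteDimensional_pointsField :
    FiniteDimensional L (pointsField (algebraMap R L) R' Ω) := by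
  rw [pointsField_eq_pointsField_id]
  exact finiteDimensional_pointsField_id

theorem isGalois_pointsField [Normal L Ω] [Algebra.FormallyUnramified R R'] :
    IsGalois L (pointsField (algebraMap R L) R' Ω) := by
  rw [pointsField_eq_pointsField_id]
  exact { to_isSeparable := isSeparable_pointsField_id, to_normal := normal_pointsField_id }

theorem card_algEquiv_pointsField_le [Module.Free R R'] :
    Nat.card (pointsField (algebraMap R L) R' Ω ≃ₐ[L] pointsField (algebraMap R L) R' Ω) ≤
      (Module.finrank R R').factorial := by
  have : Nontrivial R := (algebraMap R L).domain_nontrivial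
  rw [pointsField_eq_pointsField_id, ← Module.finrank_baseChange (R := L)]
  exact card_algEquiv_pointsField_id_le

end GaloisFibre

section FieldOfPoints

variable {L : Type u} [Field L]

theorem evalAt_comp {U V : Scheme.{u}} (t : Spec (.of L) ⟶ U) (g : U ⟶ V)
    (f : Γ(V, ⊤)) : evalAt (t ≫ g) f = evalAt t (g.appTop.hom f) := by
  rw [evalAt, evalAt, Scheme.Hom.comp_appTop, CommRingCat.hom_comp, RingHom.comp_apply]

theorem evalAt_specMap {R : CommRingCat.{u}} (φ : R ⟶ .of L) (f : Γ(Spec R, ⊤)) :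
    evalAt (Spec.map φ) f = φ.hom ((Scheme.ΓSpecIso R).hom.hom f) :=
  congrArg (fun g ↦ g.hom f) (Scheme.ΓSpecIso_naturality φ)

variable {Ω : Type u} [Field Ω]

theorem evalAt_mem_range {X : Scheme.{u}} (x : Spec (.of Ω) ⟶ X) (g : Γ(X, ⊤)) :
    evalAt x g ∈ Set.range (Scheme.SpecToEquivOfField Ω X x).2.hom := by
  have h := (Scheme.SpecToEquivOfField Ω X).symm_apply_apply x
  rw [Scheme.SpecToEquivOfField_symm_apply] at h
  rw [← congrArg (fun z ↦ evalAt z g) h, evalAt_comp, evalAt_specMap]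
  exact ⟨_, rfl⟩

theorem range_SpecToEquivOfField_comp_subset {X : Scheme.{u}}
    (i : L →+* Ω) (y : Spec (.of L) ⟶ X) :
    Set.range (Scheme.SpecToEquivOfField Ω X (Spec.map (CommRingCat.ofHom i) ≫ y)).2.hom ⊆
      Set.range i := by
  have h := (Scheme.SpecToEquivOfField L X).symm_apply_apply y
  rw [Scheme.SpecToEquivOfField_symm_apply] at h
  have h' : Spec.map (CommRingCat.ofHom i) ≫ y = (Scheme.SpecToEquivOfField Ω X).symm
      ⟨_, (Scheme.SpecToEquivOfField L X y).2 ≫ CommRingCat.ofHom i⟩ := by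
    rw [Scheme.SpecToEquivOfField_symm_apply, Spec.map_comp, Category.assoc, h]
  rw [h', Equiv.apply_symm_apply]
  rintro _ ⟨z, rfl⟩
  exact ⟨_, rfl⟩

variable [Algebra L Ω] {R R' : Type u} [CommRing R] [CommRing R'] [Algebra R R']
  {X : Scheme.{u}} {q : X ⟶ Spec (.of L)} {g : X ⟶ Spec (.of R')} {t : R →+* L}
  (h : IsPullback g q (Spec.map (CommRingCat.ofHom (algebraMap R R')))
    (Spec.map (CommRingCat.ofHom t)))
include h

theorem pointsField_le_fieldOfPoints :
    pointsField t R' Ω ≤ fieldOfPoints q Ω := by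
  refine pointsField_le_iff.mpr fun ψ hψ b ↦ ?_
  have hsq : Spec.map (CommRingCat.ofHom ψ) ≫ Spec.map (CommRingCat.ofHom (algebraMap R R')) =
      Spec.map (CommRingCat.ofHom (algebraMap L Ω)) ≫ Spec.map (CommRingCat.ofHom t) := by
    simp only [← Spec.map_comp, ← CommRingCat.ofHom_comp, hψ]
  let x : KPoints q Ω := ⟨h.lift _ _ hsq, h.lift_snd _ _ hsq⟩
  have hx : evalAt x.1 (g.appTop.hom ((Scheme.ΓSpecIso (.of R')).inv.hom b)) = ψ b := by
    rw [← evalAt_comp, h.lift_fst, evalAt_specMap]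
    simp
  rw [← hx]
  exact IntermediateField.subset_adjoin L _ (Set.mem_iUnion.mpr ⟨x, evalAt_mem_range x.1 _⟩)

theorem exists_SpecMap_algebraMap_pointsField_comp_eq (x : KPoints q Ω) :
    ∃ y : Spec (.of (pointsField t R' Ω)) ⟶ X,
      Spec.map (CommRingCat.ofHom (algebraMap (pointsField t R' Ω) Ω)) ≫ y = x.1 := by
  obtain ⟨ψ, hψx⟩ := Spec.map_surjective (x.1 ≫ g)
  have hψ : ψ.hom.comp (algebraMap R R') = (algebraMap L Ω).comp t := by
    suffices CommRingCat.ofHom (algebraMap R R') ≫ ψ =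
        CommRingCat.ofHom t ≫ CommRingCat.ofHom (algebraMap L Ω) from
      congrArg CommRingCat.Hom.hom this
    apply Spec.map_injective
    rw [Spec.map_comp, Spec.map_comp, hψx, Category.assoc, h.w, reassoc_of% x.2]
  let ψF : R' →+* pointsField t R' Ω := ψ.hom.codRestrict _ (apply_mem_pointsField hψ)
  have hsq : Spec.map (CommRingCat.ofHom ψF) ≫ Spec.map (CommRingCat.ofHom (algebraMap R R')) =
      Spec.map (CommRingCat.ofHom (algebraMap L _)) ≫ Spec.map (CommRingCat.ofHom t) := by
    simp only [← Spec.map_comp, ← CommRingCat.ofHom_comp]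
    congr 2
    ext r
    exact RingHom.congr_fun hψ r
  refine ⟨h.lift _ _ hsq, h.hom_ext ?_ ?_⟩
  · rw [Category.assoc, h.lift_fst, ← hψx, ← Spec.map_comp]
    rfl
  · rw [Category.assoc, h.lift_snd, ← Spec.map_comp]
    exact x.2.symm

theorem fieldOfPoints_le_pointsField : fieldOfPoints q Ω ≤ pointsField t R' Ω := by
  refine IntermediateField.adjoin_le_iff.mpr (Set.iUnion_subset fun x ↦ ?_)
  obtain ⟨y, hy⟩ := exists_SpecMap_algebraMap_pointsField_comp_eq h x
  rw [← hy]
  refine (range_SpecToEquivOfField_comp_subset _ _).trans ?_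
  rintro _ ⟨z, rfl⟩
  exact z.2

theorem fieldOfPoints_eq_pointsField :
    fieldOfPoints q Ω = pointsField t R' Ω :=
  (fieldOfPoints_le_pointsField h).antisymm (pointsField_le_fieldOfPoints h)

end FieldOfPoints

section AffineCharts

theorem isPullback_fromSpec_app {S S' : Scheme.{u}} (f : S' ⟶ S) [IsAffineHom f] {W : S.Opens}
    (hW : IsAffineOpen W) :
    IsPullback (hW.preimage f).fromSpec (Spec.map (f.app W)) f hW.fromSpec := by
  refine (IsOpenImmersion.isPullback _ _ _ _ ?_ ?_).flip
  · rw [← hW.SpecMap_appLE_fromSpec f (hW.preimage f) le_rfl, Scheme.Hom.appLE_eq_app]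
  · rw [hW.opensRange_fromSpec, (hW.preimage f).opensRange_fromSpec]

theorem exists_free_localizationAway_tensorProduct {A : Type u} (A' : Type u) [CommRing A]
    [CommRing A'] [Algebra A A'] [Module.FinitePresentation A A'] [Module.Flat A A']
    (q : PrimeSpectrum A) :
    ∃ r ∉ q.asIdeal, Module.Free (Localization.Away r) (Localization.Away r ⊗[A] A') := by
  have : Module.Free (Localization.AtPrime q.asIdeal)
      (LocalizedModule q.asIdeal.primeCompl A') := by
    have hq : q ∈ Module.freeLocus A A' := Module.freeLocus_eq_univ (R := A) (M := A') ▸ trivial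
    exact hq
  obtain ⟨r, hr, _, -⟩ := Module.FinitePresentation.exists_free_localizedModule_powers
    q.asIdeal.primeCompl (LocalizedModule.mkLinearMap q.asIdeal.primeCompl A')
    (Localization.AtPrime q.asIdeal)
  exact ⟨r, hr, .of_equiv (LocalizedModule.equivTensorProduct (Submonoid.powers r) A')⟩

theorem exists_isPullback_SpecMap_free_etale {S S' : Scheme.{u}} (f : S' ⟶ S) [IsFinite f] [Etale f]
    (x : S) :
    ∃ (R R' : Type u) (_ : CommRing R) (_ : CommRing R') (_ : Algebra R R')
      (j : Spec (.of R) ⟶ S) (i : Spec (.of R') ⟶ S') (_ : IsOpenImmersion j),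
      Module.Finite R R' ∧ Module.Free R R' ∧ Algebra.Etale R R' ∧ x ∈ j.opensRange ∧
      IsPullback i (Spec.map (CommRingCat.ofHom (algebraMap R R'))) f j := by
  obtain ⟨W, hW, hxW, -⟩ := exists_isAffineOpen_mem_and_subset (X := S) (x := x) (U := ⊤) trivial
  algebraize [(f.app W).hom]
  have : Module.Finite Γ(S, W) Γ(S', f ⁻¹ᵁ W) := f.finite_app W hW
  have : Algebra.Etale Γ(S, W) Γ(S', f ⁻¹ᵁ W) := by
    have h := f.etale_appLE hW (hW.preimage f) le_rfl
    rwa [Scheme.Hom.appLE_eq_app] at h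
  have : Module.FinitePresentation Γ(S, W) Γ(S', f ⁻¹ᵁ W) :=
    .of_finite_of_finitePresentation _ _
  obtain ⟨q, hqx⟩ : x ∈ Set.range hW.fromSpec := by rwa [hW.range_fromSpec]
  obtain ⟨r, hr, _⟩ := exists_free_localizationAway_tensorProduct Γ(S', f ⁻¹ᵁ W) q
  let loc := Spec.map (CommRingCat.ofHom (algebraMap Γ(S, W) (Localization.Away r)))
  have : IsOpenImmersion loc := .of_isLocalization r
  obtain ⟨y, hy⟩ : q ∈ Set.range (PrimeSpectrum.comap (algebraMap _ (Localization.Away r))) := by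
    rwa [PrimeSpectrum.localization_away_comap_range _ r]
  refine ⟨Localization.Away r, Localization.Away r ⊗[Γ(S, W)] Γ(S', f ⁻¹ᵁ W), inferInstance,
    inferInstance, inferInstance, loc ≫ hW.fromSpec, _, inferInstance, inferInstance,
    inferInstance, inferInstance, ⟨y, ?_⟩, IsPullback.paste_horiz
      (isPullback_SpecMap_of_isPushout _ _ _ _ (CommRingCat.isPushout_tensorProduct _ _ _)).flip
      (isPullback_fromSpec_app f hW)⟩
  rw [← hqx, ← hy]
  rfl

end AffineCharts

section PointsOfCharts

variable {K : Type u} [Field K] {S S' : Scheme.{u}} {p : S ⟶ Spec (.of K)}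
  {L : Type u} [Field L] {R R' : Type u} [CommRing R] {j : Spec (.of R) ⟶ S}

theorem eq_of_SpecMap_comp_eq [Mono j] {t t' : R →+* L}
    (h : Spec.map (CommRingCat.ofHom t) ≫ j = Spec.map (CommRingCat.ofHom t') ≫ j) : t = t' :=
  congrArg CommRingCat.Hom.hom (Spec.map_injective ((cancel_mono j).mp h))

theorem fibreField_eq_pointsField [Algebra K L] [CommRing R'] [Algebra R R'] {f : S' ⟶ S}
    {i : Spec (.of R') ⟶ S'}
    (h : IsPullback i (Spec.map (CommRingCat.ofHom (algebraMap R R'))) f j) {s : KPoints p L}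
    {t : R →+* L} (hst : Spec.map (CommRingCat.ofHom t) ≫ j = s.1)
    (Ω : Type u) [Field Ω] [Algebra L Ω] :
    fibreField f s Ω = pointsField t R' Ω := by
  have hs : IsPullback (pullback.fst f s.1) (pullback.snd f s.1) f
      (Spec.map (CommRingCat.ofHom t) ≫ j) := hst ▸ IsPullback.of_hasPullback f s.1
  have hlift := h.lift_fst (pullback.fst f s.1)
    (pullback.snd f s.1 ≫ Spec.map (CommRingCat.ofHom t)) (by rw [hs.w, Category.assoc])
  rw [← hlift] at hs
  exact fieldOfPoints_eq_pointsField (.of_right hs (h.lift_snd _ _ _) h)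

variable [IsOpenImmersion j]

theorem exists_SpecMap_comp_eq {s : Spec (.of L) ⟶ S}
    (hs : s (IsLocalRing.closedPoint L) ∈ j.opensRange) :
    ∃ t : R →+* L, Spec.map (CommRingCat.ofHom t) ≫ j = s := by
  have hrange : Set.range s ⊆ Set.range j := by
    rintro _ ⟨y, rfl⟩
    rwa [Subsingleton.elim (α := PrimeSpectrum L) y (IsLocalRing.closedPoint L)]
  obtain ⟨t, ht⟩ := Spec.map_surjective (IsOpenImmersion.lift j s hrange)
  exact ⟨t.hom, by rw [CommRingCat.ofHom_hom, ht, IsOpenImmersion.lift_fac]⟩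

variable [Algebra K L] [TopologicalSpace L]

theorem isOpen_setOf_exists_SpecMap_comp_eq (a : R) {V : Set L} (hV : IsOpen V) :
    IsOpen {s : KPoints p L |
      ∃ t : R →+* L, Spec.map (CommRingCat.ofHom t) ≫ j = s.1 ∧ t a ∈ V} := by
  refine TopologicalSpace.isOpen_generateFrom_of_mem ⟨j.opensRange, isAffineOpen_opensRange j,
    j.isoOpensRange.inv.appTop.hom ((Scheme.ΓSpecIso (.of R)).inv.hom a), V, hV, ?_⟩
  ext s
  constructor
  · rintro ⟨t, ht, hta⟩
    refine ⟨Spec.map (CommRingCat.ofHom t) ≫ j.isoOpensRange.hom, by simpa using ht, ?_⟩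
    rw [← evalAt_comp, Category.assoc, Iso.hom_inv_id, Category.comp_id, evalAt_specMap]
    simpa [← CommRingCat.comp_apply] using hta
  · rintro ⟨t', ht', hta⟩
    obtain ⟨t, ht⟩ := Spec.map_surjective (t' ≫ j.isoOpensRange.inv)
    refine ⟨t.hom, ?_, ?_⟩
    · rw [CommRingCat.ofHom_hom, ht, ← ht', Category.assoc, Scheme.Hom.isoOpensRange_inv_comp]
    · rw [← evalAt_comp, ← ht, evalAt_specMap] at hta
      simpa [← CommRingCat.comp_apply] using hta

theorem exists_tendsto_SpecMap_comp_eq {s : KPoints p L} {t : R →+* L}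
    (hst : Spec.map (CommRingCat.ofHom t) ≫ j = s.1) :
    ∃ τ : KPoints p L → R →+* L,
      (∀ᶠ s' in 𝓝 s, Spec.map (CommRingCat.ofHom (τ s')) ≫ j = s'.1) ∧
      ∀ a, Tendsto (τ · a) (𝓝 s) (𝓝 (t a)) := by
  classical
  let τ (s' : KPoints p L) : R →+* L :=
    if h : ∃ t', Spec.map (CommRingCat.ofHom t') ≫ j = s'.1 then h.choose else t
  have hτ {s' : KPoints p L} {t' : R →+* L} (h : Spec.map (CommRingCat.ofHom t') ≫ j = s'.1) :
      τ s' = t' := by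
    have h' : ∃ t', Spec.map (CommRingCat.ofHom t') ≫ j = s'.1 := ⟨t', h⟩
    exact (dif_pos h').trans (eq_of_SpecMap_comp_eq (h'.choose_spec.trans h.symm))
  have hnhds (a : R) {V : Set L} (hV : IsOpen V) (hta : t a ∈ V) :
      ∀ᶠ s' : KPoints p L in 𝓝 s, ∃ t', Spec.map (CommRingCat.ofHom t') ≫ j = s'.1 ∧ t' a ∈ V :=
    (isOpen_setOf_exists_SpecMap_comp_eq a hV).mem_nhds ⟨t, hst, hta⟩
  refine ⟨τ, ?_, fun a ↦ tendsto_nhds.mpr fun V hV hta ↦ ?_⟩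
  · filter_upwards [hnhds 0 isOpen_univ trivial] with s' ⟨t', ht', _⟩
    rwa [hτ ht']
  · filter_upwards [hnhds a hV hta] with s' ⟨t', ht', hta'⟩
    rwa [Set.mem_preimage, hτ ht']

end PointsOfCharts

section FibreField

variable {K : Type u} [Field K] {S S' : Scheme.{u}} {p : S ⟶ Spec (.of K)} (f : S' ⟶ S)
  [IsFinite f] [Etale f] {L : Type u} [Field L] [Algebra K L]
  (Ω : Type u) [Field Ω] [Algebra L Ω]

theorem finiteDimensional_fibreField (s : KPoints p L) :
    FiniteDimensional L (fibreField f s Ω) := by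
  obtain ⟨R, R', _, _, _, j, i, _, _, _, _, hs, h⟩ :=
    exists_isPullback_SpecMap_free_etale f (s.1 (IsLocalRing.closedPoint L))
  obtain ⟨t, ht⟩ := exists_SpecMap_comp_eq hs
  rw [fibreField_eq_pointsField h ht]
  let := t.toAlgebra
  exact finiteDimensional_pointsField

theorem isGalois_fibreField [Normal L Ω] (s : KPoints p L) : IsGalois L (fibreField f s Ω) := by
  obtain ⟨R, R', _, _, _, j, i, _, _, _, _, hs, h⟩ :=
    exists_isPullback_SpecMap_free_etale f (s.1 (IsLocalRing.closedPoint L))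
  obtain ⟨t, ht⟩ := exists_SpecMap_comp_eq hs
  rw [fibreField_eq_pointsField h ht]
  let := t.toAlgebra
  exact isGalois_pointsField

theorem exists_forall_mem_opens_card_algEquiv_fibreField_le (p : S ⟶ Spec (.of K)) (x : S) :
    ∃ (W : S.Opens) (N : ℕ), x ∈ W ∧ ∀ s : KPoints p L, s.1 (IsLocalRing.closedPoint L) ∈ W →
      Nat.card (fibreField f s Ω ≃ₐ[L] fibreField f s Ω) ≤ N := by
  obtain ⟨R, R', _, _, _, j, i, _, _, _, _, hx, h⟩ := exists_isPullback_SpecMap_free_etale f x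
  refine ⟨j.opensRange, (Module.finrank R R').factorial, hx, fun s hs ↦ ?_⟩
  obtain ⟨t, ht⟩ := exists_SpecMap_comp_eq hs
  rw [fibreField_eq_pointsField h ht]
  let := t.toAlgebra
  exact card_algEquiv_pointsField_le

theorem exists_forall_card_algEquiv_fibreField_le [CompactSpace S] (p : S ⟶ Spec (.of K)) :
    ∃ N, ∀ s : KPoints p L, Nat.card (fibreField f s Ω ≃ₐ[L] fibreField f s Ω) ≤ N := by
  choose W N hxW hN using exists_forall_mem_opens_card_algEquiv_fibreField_le f (L := L) Ω p
  obtain ⟨F, hF⟩ := CompactSpace.elim_nhds_subcover (fun x ↦ (W x : Set S))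
    fun x ↦ (W x).isOpen.mem_nhds (hxW x)
  refine ⟨∑ x ∈ F, N x, fun s ↦ ?_⟩
  obtain ⟨x, hxF, hsx⟩ :=
    Set.mem_iUnion₂.mp (hF.ge (Set.mem_univ (s.1 (IsLocalRing.closedPoint L))))
  exact (hN x s hsx).trans (Finset.single_le_sum (fun _ _ ↦ Nat.zero_le _) hxF)

theorem HasStableSimpleRoots.isLocallyConstant_fibreField [TopologicalSpace L]
    [IsTopologicalRing L] [T1Space L] (hL : HasStableSimpleRoots L) :
    IsLocallyConstant fun s : KPoints p L ↦ fibreField f s Ω := by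
  refine IsLocallyConstant.iff_eventually_eq _ |>.mpr fun s ↦ ?_
  obtain ⟨R, R', _, _, _, j, i, _, _, _, _, hs, h⟩ :=
    exists_isPullback_SpecMap_free_etale f (s.1 (IsLocalRing.closedPoint L))
  obtain ⟨t, ht⟩ := exists_SpecMap_comp_eq hs
  obtain ⟨τ, hτ, hτ_tendsto⟩ := exists_tendsto_SpecMap_comp_eq ht
  filter_upwards [hτ, hL.eventually_pointsField_eq (R' := R') (Ω := Ω) hτ_tendsto] with s' hs' heq
  rw [fibreField_eq_pointsField h hs', fibreField_eq_pointsField h ht, heq]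

end FibreField

theorem exists_subgroup_perm_nonempty_mulEquiv {N : ℕ} (G : Type*) [Group G] [Finite G]
    (hG : Nat.card G ≤ N) : ∃ A : Subgroup (Equiv.Perm (Fin N)), Nonempty (G ≃* A) := by
  let ι : G ↪ Fin N := (Finite.equivFin G).toEmbedding.trans (Fin.castLEEmb hG)
  let φ : G →* Equiv.Perm (Fin N) :=
    (Equiv.Perm.viaEmbeddingHom ι).comp (MulAction.toPermHom G G)
  have hφ : Function.Injective φ :=
    (Equiv.Perm.viaEmbeddingHom_injective ι).comp MulAction.toPerm_injective
  exact ⟨φ.range, ⟨MonoidHom.ofInjective hφ⟩⟩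

theorem exists_group_representatives_card_le (N : ℕ) :
    ∃ (n : ℕ) (H : Fin n → Type) (_ : ∀ i, Group (H i)), (∀ i, Finite (H i)) ∧
      (∀ i j, Nonempty (H i ≃* H j) → i = j) ∧
      ∀ (G : Type u) [Group G] [Finite G], Nat.card G ≤ N → ∃ i, Nonempty (G ≃* H i) := by
  let isoSetoid : Setoid (Subgroup (Equiv.Perm (Fin N))) :=
    { r := fun A B ↦ Nonempty (A ≃* B)
      iseqv := ⟨fun A ↦ ⟨.refl A⟩, fun ⟨e⟩ ↦ ⟨e.symm⟩, fun ⟨e⟩ ⟨e'⟩ ↦ ⟨e.trans e'⟩⟩ }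
  obtain ⟨n, ⟨k⟩⟩ := Finite.exists_equiv_fin (_root_.Quotient isoSetoid)
  refine ⟨n, fun i ↦ (k.symm i).out, inferInstance, inferInstance, fun i j h ↦ ?_,
    fun G _ _ hG ↦ ?_⟩
  · exact k.symm.injective (Quotient.out_equiv_out.mp h)
  · obtain ⟨A, ⟨e⟩⟩ := exists_subgroup_perm_nonempty_mulEquiv G hG
    obtain ⟨e'⟩ : isoSetoid A (k.symm (k ⟦A⟧)).out := by
      rw [Equiv.symm_apply_apply]
      exact Setoid.symm (Quotient.mk_out A)
    exact ⟨k ⟦A⟧, ⟨e.trans e'⟩⟩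

theorem mainTheorem5_general {K : Type u} [Field K] {S S' : Scheme.{u}}
    (p : S ⟶ Spec (.of K)) [QuasiCompact p] (f : S' ⟶ S) [IsFinite f] [Etale f]
    (L : Type u) [Field L] [TopologicalSpace L] [IsTopologicalRing L] [T1Space L]
    (hL : HasStableSimpleRoots L) [Algebra K L]
    (Ω : Type u) [Field Ω] [Algebra L Ω] [Normal L Ω] :
    (∀ s : KPoints p L, FiniteDimensional L (fibreField f s Ω) ∧ IsGalois L (fibreField f s Ω)) ∧
    ∃ (n : ℕ) (H : Fin n → Type) (_ : ∀ i, Group (H i)) (_ : ∀ i, Finite (H i))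
      (U : Fin n → Set (KPoints p L)),
      (∀ i, IsOpen (U i)) ∧
      (⋃ i, U i) = Set.univ ∧
      (∀ i j, i ≠ j → Disjoint (U i) (U j)) ∧
      ∀ (i : Fin n) (s : KPoints p L),
        s ∈ U i ↔ Nonempty ((fibreField f s Ω ≃ₐ[L] fibreField f s Ω) ≃* H i) := by
  have : CompactSpace S := QuasiCompact.compactSpace_of_compactSpace p
  obtain ⟨N, hN⟩ := exists_forall_card_algEquiv_fibreField_le f Ω (L := L) p
  obtain ⟨n, H, _, _, H_inj, H_surj⟩ := exists_group_representatives_card_le.{u} N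
  let U (i : Fin n) : Set (KPoints p L) :=
    {s | Nonempty ((fibreField f s Ω ≃ₐ[L] fibreField f s Ω) ≃* H i)}
  refine ⟨fun s ↦ ⟨finiteDimensional_fibreField f Ω s, isGalois_fibreField f Ω s⟩, n, H,
    inferInstance, inferInstance, U, fun i ↦ ?_, Set.iUnion_eq_univ_iff.mpr fun s ↦ ?_,
    fun i j hij ↦ ?_, fun i s ↦ Iff.rfl⟩
  · exact hL.isLocallyConstant_fibreField f Ω {F | Nonempty ((F ≃ₐ[L] F) ≃* H i)}
  · have := finiteDimensional_fibreField f Ω s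
    exact H_surj _ (hN s)
  · exact Set.disjoint_left.mpr fun s ⟨e⟩ ⟨e'⟩ ↦ hij (H_inj i j ⟨e.symm.trans e'⟩)

theorem mainTheorem5 {K : Type u} [Field K] {S S' : Scheme.{u}}
    (p : S ⟶ Spec (.of K)) [LocallyOfFiniteType p] [QuasiCompact p]
    (f : S' ⟶ S) [IsFinite f] [Etale f]
    (L : Type u) [NontriviallyNormedField L] (hL : IsLocalField L) [Algebra K L]
    (Lbar : Type u) [Field Lbar] [Algebra L Lbar] [IsAlgClosure L Lbar] :
    (∀ s : KPoints p L,
      FiniteDimensional L (fibreField f s Lbar) ∧ IsGalois L (fibreField f s Lbar)) ∧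
    ∃ (n : ℕ) (H : Fin n → Type) (_ : ∀ i, Group (H i)) (_ : ∀ i, Finite (H i))
      (U : Fin n → Set (KPoints p L)),
      (∀ i, IsOpen (U i)) ∧
      (⋃ i, U i) = Set.univ ∧
      (∀ i j, i ≠ j → Disjoint (U i) (U j)) ∧
      ∀ (i : Fin n) (s : KPoints p L),
        s ∈ U i ↔ Nonempty ((fibreField f s Lbar ≃ₐ[L] fibreField f s Lbar) ≃* H i) := by
  have := IsAlgClosure.normal L Lbar
  exact mainTheorem5_general p f L hL.hasStableSimpleRoots Lbar
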